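/- A Deza graph with parameters $(n,k,b,a)$, $b\ge a$, is a finite $k$-regular graph of order $n$, neither complete nor edgeless, in which any two distinct vertices have $b$ or $a$ common neighbours. Its children $G_A$ and $G_B$ are the graphs on the same vertex set in which two distinct vertices are adjacent if and only if they have exactly $a$, respectively exactly $b$, common neighbours (if $a=b$, then $G_B$ is edgeless by convention). A divisible design graph is a Deza graph whose children are a complete multipartite graph and its complement, neither child being edgeless (so that $a\ne b$ and both values occur). A connected graph of diameter $d$ is distance-regular with intersection numbers $a_i,b_i,c_i$ ($0\le i\le d$) if for all $i$ and all vertices $x,y$ at distance $i$, the numbers of neighbours of $y$ at distance $i+1$, $i$ and $i-1$ from $x$ equal $b_i$, $a_i$ and $c_i$, respectively. It is antipodal if being at distance $d$ defines a disjoint union of cliques on the vertex set. **Corollary.** Let $k,m\ge 0$ be integers and let $G$ be a divisible design graph whose adjacency spectrum (eigenvalues with multiplicities) is $$\{k^{1},\ \sqrt{k}^{\,m},\ (-1)^{k},\ (-\sqrt{k})^{m}\},$$ so that $G$ has order $n=2m+k+1$. If $n$ divides $k^2-1$, then $G$ is an antipodal distance-regular graph of diameter $d=3$ with $a_1=c_2=(k^2-1)/n$.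 -/

import Mathlib

namespace SimpleGraph

universe u

section Deza

variable {V : Type u} [Fintype V] [DecidableEq V] (G : SimpleGraph V) [DecidableRel G.Adj]

/-- A Deza graph with parameters `(n, k, b, a)`: a `k`-regular graph of order `n`, neither complete
nor edgeless, in which any two distinct vertices have `b` or `a` common neighbours, `a ≤ b`. -/
structure IsDezaWith (n k b a : ℕ) : Prop where
  card : Fintype.card V = n
  regular : G.IsRegularOfDegree k
  le : a ≤ b
  common : ∀ x y : V, x ≠ y →
    Fintype.card (G.commonNeighbors x y) = b ∨ Fintype.card (G.commonNeighbors x y) = a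
  ne_top : G ≠ ⊤
  ne_bot : G ≠ ⊥

/-- The child `G_A`: distinct vertices are adjacent if they have exactly `a` common neighbours in
`G`. -/
def childA (a : ℕ) : SimpleGraph V where
  Adj x y := x ≠ y ∧ Fintype.card (G.commonNeighbors x y) = a
  symm := ⟨fun x y h => ⟨h.1.symm, by simpa only [G.commonNeighbors_symm y x] using h.2⟩⟩
  loopless := ⟨fun _ h => h.1 rfl⟩

/-- The child `G_B`: distinct vertices are adjacent if they have exactly `b` common neighbours in
`G`; by convention it is edgeless when `b = a`. -/
def childB (b a : ℕ) : SimpleGraph V where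
  Adj x y := x ≠ y ∧ b ≠ a ∧ Fintype.card (G.commonNeighbors x y) = b
  symm := ⟨fun x y h =>
    ⟨h.1.symm, h.2.1, by simpa only [G.commonNeighbors_symm y x] using h.2.2⟩⟩
  loopless := ⟨fun _ h => h.1 rfl⟩

/-- A divisible design graph: a Deza graph whose children are a complete multipartite graph and
its complement. As the children have to be strongly regular, neither of them is edgeless (so
neither is complete, both values `a ≠ b` occur, and the complete multipartite child has at least
two parts, not all of size one). -/
def IsDivisibleDesignGraph : Prop :=
  ∃ n k b a : ℕ, G.IsDezaWith n k b a ∧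
    G.childA a ≠ ⊥ ∧ G.childB b a ≠ ⊥ ∧ G.childB b a = (G.childA a)ᶜ ∧
    ((G.childA a).IsCompleteMultipartite ∨ (G.childB b a).IsCompleteMultipartite)

/-- The spectrum of a graph: the multiset of the eigenvalues of its adjacency matrix, with
multiplicities (a real symmetric matrix has all its eigenvalues in `ℝ`). -/
noncomputable def adjSpectrum : Multiset ℝ :=
  (G.adjMatrix ℝ).charpoly.roots

end Deza

section DistanceRegular

variable {V : Type u} (G : SimpleGraph V)

/-- `G` is a (finite) distance-regular graph with intersection numbers `a i`, `b i`, `c i`,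
`0 ≤ i ≤ d`, where `d` is the diameter of `G`. -/
structure IsDistanceRegularWith (a b c : ℕ → ℕ) : Prop where
  finite : Finite V
  connected : G.Connected
  b_eq : ∀ i ≤ G.diam, ∀ x y : V, G.dist x y = i →
    {z : V | G.Adj y z ∧ G.dist x z = i + 1}.ncard = b i
  a_eq : ∀ i ≤ G.diam, ∀ x y : V, G.dist x y = i →
    {z : V | G.Adj y z ∧ G.dist x z = i}.ncard = a i
  c_eq : ∀ i ≤ G.diam, ∀ x y : V, G.dist x y = i →
    {z : V | G.Adj y z ∧ G.dist x z + 1 = i}.ncard = c i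

/-- The distance-`i` graph of `G`. -/
def distanceGraph (i : ℕ) : SimpleGraph V where
  Adj x y := x ≠ y ∧ G.dist x y = i
  symm := ⟨fun x y h => ⟨h.1.symm, by rw [G.dist_comm]; exact h.2⟩⟩
  loopless := ⟨fun _ h => h.1 rfl⟩

/-- `G` is a disjoint union of cliques. -/
def IsDisjointUnionOfCliques : Prop :=
  ∀ x y z : V, G.Adj x y → G.Adj y z → x ≠ z → G.Adj x z

/-- A graph of diameter `d` is antipodal if its distance-`d` graph is a disjoint union of
cliques. -/
def IsAntipodal : Prop :=
  (G.distanceGraph G.diam).IsDisjointUnionOfCliques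

end DistanceRegular

end SimpleGraph

/-! ### Functional calculus for real symmetric matrices. -/

open Matrix Polynomial

/-! Let `R` be the 0-1 matrix of the partition into classes and `J` the all-ones matrix. The design
property says `A² = (k - l₁) I + (l₁ - l₂) R + l₂ J`. Hence `A²` acts as `k - l₁` on vectors with
zero sum on every class, and as `k² - l₂ n` on class-constant vectors with total sum zero. By the
spectrum both scalars lie in `{k², 1, k}`, and they differ. Row sums, the trace of `A⁴` and the
divisibility hypothesis leave only `k - l₁ = k` and `k² - l₂ n = 1` (`IsDivisible.parameters`).

On the class-constant sum-zero vectors `A² = 1`, so `A` has eigenvalues `±1` there; as `k ≥ 2`, `1`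
is not in the spectrum, so `A = -1` there. This means `A R = J - R`: a vertex has one neighbour in
each foreign class and none in its own (`card_neighbors_in_class`). Since `l₁ = 0`, `G` is an
antipodal cover of a complete graph with `μ = l₂ = (k² - 1) / n`. In such a graph distances can be
read off from the classes and adjacency, which gives the intersection numbers. -/

theorem Matrix.aeval_diagonal_pi {n : Type*} [Fintype n] [DecidableEq n] (p : ℝ[X]) (d : n → ℝ) :
    aeval (diagonal d) p = diagonal fun i => p.eval (d i) := by
  have h := Polynomial.aeval_algHom_apply (Matrix.diagonalAlgHom (n := n) (α := ℝ) ℝ) d p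
  have h' : aeval d p = fun i => p.eval (d i) := by
    ext i
    simp [Polynomial.coe_aeval_eq_eval]
  rw [h'] at h
  exact h

theorem Matrix.IsHermitian.aeval_eq {n : Type*} [Fintype n] [DecidableEq n] {A : Matrix n n ℝ}
    (hA : A.IsHermitian) (p : ℝ[X]) :
    aeval A p = Unitary.conjStarAlgAut ℝ _ hA.eigenvectorUnitary
      (diagonal fun i => p.eval (hA.eigenvalues i)) := by
  conv_lhs => rw [hA.spectral_theorem]
  have h := Polynomial.aeval_algHom_apply
    (Unitary.conjStarAlgAut ℝ _ hA.eigenvectorUnitary).toAlgEquiv.toAlgHom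
    (diagonal (hA.eigenvalues)) p
  rw [Matrix.aeval_diagonal_pi] at h
  exact h

/-- A polynomial vanishing on the spectrum of a real symmetric matrix annihilates the matrix. -/
theorem Matrix.IsHermitian.aeval_eq_zero {n : Type*} [Fintype n] [DecidableEq n]
    {A : Matrix n n ℝ} (hA : A.IsHermitian) (p : ℝ[X])
    (h : ∀ t ∈ A.charpoly.roots, p.eval t = 0) : aeval A p = 0 := by
  have h0 : (fun i => p.eval (hA.eigenvalues i)) = 0 := by
    ext i
    refine h _ ?_
    rw [hA.roots_charpoly_eq_eigenvalues]
    simp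
  rw [hA.aeval_eq, h0]
  simp

theorem Matrix.IsHermitian.trace_pow {n : Type*} [Fintype n] [DecidableEq n]
    {A : Matrix n n ℝ} (hA : A.IsHermitian) (j : ℕ) :
    (A ^ j).trace = (A.charpoly.roots.map (· ^ j)).sum := by
  have h := hA.aeval_eq (X ^ j)
  simp only [map_pow, aeval_X, eval_pow, eval_X] at h
  rw [h, Unitary.conjStarAlgAut_apply, Matrix.trace_mul_cycle, Unitary.coe_star_mul_self, one_mul,
    hA.roots_charpoly_eq_eigenvalues, Matrix.trace_diagonal]
  simp

/-! ### Matrices of equivalence relations with classes of equal size. -/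

namespace Setoid

variable {V : Type*} (r : Setoid V) [DecidableRel r]

/-- The `0`-`1` matrix of an equivalence relation. -/
def relMatrix : Matrix V V ℝ := Matrix.of fun x y => if r x y then 1 else 0

/-- The number of elements of the class of `x`. -/
def classCard [Fintype V] (x : V) : ℕ := (Finset.univ.filter fun y => r x y).card

theorem relMatrix_transpose : r.relMatrixᵀ = r.relMatrix := by
  ext x y
  simp only [relMatrix, Matrix.transpose_apply, Matrix.of_apply, r.comm']

theorem sum_relMatrix [Fintype V] (x : V) : ∑ y, r.relMatrix x y = r.classCard x := by
  simp [relMatrix, classCard]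

theorem relMatrix_mul_ones [Fintype V] {s : ℕ} (hs : ∀ x, r.classCard x = s) :
    r.relMatrix * (Matrix.of fun _ _ => 1) =
      (s : ℝ) • (Matrix.of fun _ _ => 1 : Matrix V V ℝ) := by
  ext x y
  simp [Matrix.mul_apply, sum_relMatrix, hs]

theorem ones_mul_relMatrix [Fintype V] {s : ℕ} (hs : ∀ x, r.classCard x = s) :
    (Matrix.of fun _ _ => 1) * r.relMatrix =
      (s : ℝ) • (Matrix.of fun _ _ => 1 : Matrix V V ℝ) := by
  have h := congrArg Matrix.transpose (r.relMatrix_mul_ones hs)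
  rw [Matrix.transpose_mul, r.relMatrix_transpose] at h
  exact h

theorem relMatrix_mul_self [Fintype V] {s : ℕ} (hs : ∀ x, r.classCard x = s) :
    r.relMatrix * r.relMatrix = (s : ℝ) • r.relMatrix := by
  ext x y
  simp only [Matrix.mul_apply, Matrix.smul_apply, smul_eq_mul, ← hs x, ← sum_relMatrix,
    Finset.sum_mul]
  refine Finset.sum_congr rfl fun z _ => ?_
  simp only [relMatrix, Matrix.of_apply]
  by_cases hxz : r x z
  · have : r z y ↔ r x y := ⟨fun h => r.trans hxz h, fun h => r.trans (r.symm hxz) h⟩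
    simp [hxz, this]
  · simp [hxz]

end Setoid

/-! ### Divisible design graphs and the square of the adjacency matrix. -/

namespace SimpleGraph

variable {V : Type*} (G : SimpleGraph V) [DecidableRel G.Adj]

theorem isHermitian_adjMatrix_real : (G.adjMatrix ℝ).IsHermitian := by
  rw [Matrix.IsHermitian, Matrix.conjTranspose_eq_transpose_of_trivial, transpose_adjMatrix]

variable [Fintype V]

theorem card_adjSpectrum [DecidableEq V] : G.adjSpectrum.card = Fintype.card V := by
  rw [adjSpectrum, G.isHermitian_adjMatrix_real.roots_charpoly_eq_eigenvalues]
  simp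

theorem adjMatrix_mul_self_apply {x y : V} :
    (G.adjMatrix ℝ * G.adjMatrix ℝ) x y = Fintype.card (G.commonNeighbors x y) := by
  rw [adjMatrix_mul_apply, ← Set.toFinset_card]
  simp only [adjMatrix_apply, Finset.sum_boole, Nat.cast_inj]
  congr 1
  ext z
  simp [mem_commonNeighbors, G.adj_comm z y]

variable {G}

theorem IsRegularOfDegree.sum_adjSpectrum_sq [DecidableEq V] {d : ℕ} (h : G.IsRegularOfDegree d) :
    (G.adjSpectrum.map (fun t : ℝ => t ^ 2)).sum = (d : ℝ) * Fintype.card V := by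
  rw [adjSpectrum, ← G.isHermitian_adjMatrix_real.trace_pow, pow_two, Matrix.trace]
  simp only [Matrix.diag_apply, adjMatrix_mul_self_apply_self, h.degree_eq]
  simp [mul_comm]

/-- The common neighbour counts of a `k`-regular graph with respect to an equivalence relation:
distinct vertices have `l₁` common neighbours within a class and `l₂` across classes. -/
structure IsDivisible (G : SimpleGraph V) [DecidableRel G.Adj] (r : Setoid V) (k l₁ l₂ : ℕ) :
    Prop where
  regular : G.IsRegularOfDegree k
  ne : l₁ ≠ l₂
  common_of_rel : ∀ x y, x ≠ y → r x y → Fintype.card (G.commonNeighbors x y) = l₁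
  common_of_not_rel : ∀ x y, ¬ r x y → Fintype.card (G.commonNeighbors x y) = l₂
  exists_rel : ∃ x y, x ≠ y ∧ r x y
  exists_not_rel : ∃ x y, ¬ r x y

/-- The classes are the parts of whichever child is complete multipartite, so `l₁ < l₂` and `l₂ <
l₁` are both possible. -/
theorem IsDivisibleDesignGraph.exists_isDivisible (h : G.IsDivisibleDesignGraph) :
    ∃ (r : Setoid V) (k l₁ l₂ : ℕ), G.IsDivisible r k l₁ l₂ := by
  obtain ⟨n, k, b, a, hD, hA, hB, hAB, hm⟩ := h
  obtain ⟨u, v, huv⟩ := SimpleGraph.ne_bot_iff_exists_adj.1 hA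
  obtain ⟨u', v', huv'⟩ := SimpleGraph.ne_bot_iff_exists_adj.1 hB
  have hba : b ≠ a := huv'.2.1
  have hmem (x y : V) (hxy : x ≠ y) : (G.childA a).Adj x y ∨ (G.childB b a).Adj x y := by
    rcases hD.common x y hxy with h | h
    · exact .inr ⟨hxy, hba, h⟩
    · exact .inl ⟨hxy, h⟩
  have hnot (x y : V) (h : (G.childA a).Adj x y) (h' : (G.childB b a).Adj x y) : False :=
    hba (h'.2.2.symm.trans h.2)
  rcases hm with hm | hm
  · refine ⟨hm.setoid, k, b, a, hD.regular, hba, fun x y hxy h => ?_, fun x y h => ?_,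
      ⟨u', v', huv'.1, fun h => hnot _ _ h huv'⟩, ⟨u, v, fun h => h huv⟩⟩
    · exact ((hmem x y hxy).resolve_left h).2.2
    · exact (not_not.1 h).2
  · refine ⟨hm.setoid, k, a, b, hD.regular, hba.symm, fun x y hxy h => ?_, fun x y h => ?_,
      ⟨u, v, huv.1, fun h => hnot _ _ huv h⟩, ⟨u', v', fun h => h huv'⟩⟩
    · exact ((hmem x y hxy).resolve_right h).2
    · exact (not_not.1 h).2.2

namespace IsDivisible

variable [DecidableEq V] {r : Setoid V} [DecidableRel r] {k l₁ l₂ : ℕ}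

theorem adjMatrix_sq (h : G.IsDivisible r k l₁ l₂) :
    G.adjMatrix ℝ * G.adjMatrix ℝ = ((k : ℝ) - l₁) • (1 : Matrix V V ℝ) +
      ((l₁ : ℝ) - l₂) • r.relMatrix + (l₂ : ℝ) • (Matrix.of fun _ _ => 1) := by
  ext x y
  by_cases hxy : x = y
  · subst hxy
    rw [adjMatrix_mul_self_apply_self, h.regular.degree_eq]
    simp [Setoid.relMatrix]
  · rw [adjMatrix_mul_self_apply]
    by_cases hr : r x y
    · rw [h.common_of_rel x y hxy hr]
      simp [Setoid.relMatrix, hr, hxy]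
    · rw [h.common_of_not_rel x y hr]
      simp [Setoid.relMatrix, hr, hxy]

/-- Both sides count the walks of length two starting at `x`. -/
theorem row_sum (h : G.IsDivisible r k l₁ l₂) (x : V) :
    ((k : ℝ) - l₁) + ((l₁ : ℝ) - l₂) * r.classCard x + l₂ * Fintype.card V = k ^ 2 := by
  have h1 : ∑ y, (G.adjMatrix ℝ * G.adjMatrix ℝ) x y = k ^ 2 := by
    simp only [adjMatrix_mul_apply]
    rw [Finset.sum_comm]
    simp [adjMatrix_apply, Finset.sum_boole, ← neighborFinset_eq_filter, h.regular.degree_eq,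
      pow_two]
  rw [← h1, h.adjMatrix_sq]
  simp [Finset.sum_add_distrib, ← Finset.mul_sum, Setoid.sum_relMatrix, Matrix.one_apply, mul_comm]

/-- All classes have the same size `s`, and there are several classes, each with several
vertices. -/
theorem exists_classCard (h : G.IsDivisible r k l₁ l₂) :
    ∃ s : ℕ, (∀ x, r.classCard x = s) ∧ 2 ≤ s ∧ s < Fintype.card V := by
  obtain ⟨u, v, huv, hr⟩ := h.exists_rel
  obtain ⟨u', v', hr'⟩ := h.exists_not_rel
  have hc (x : V) : r.classCard x = r.classCard u := by
    have h1 := h.row_sum x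
    have h2 := h.row_sum u
    have h3 : ((l₁ : ℝ) - l₂) ≠ 0 := sub_ne_zero.2 (by exact_mod_cast h.ne)
    have h4 : ((l₁ : ℝ) - l₂) * r.classCard x = ((l₁ : ℝ) - l₂) * r.classCard u := by linarith
    exact_mod_cast mul_left_cancel₀ h3 h4
  refine ⟨_, hc, ?_, ?_⟩
  · exact Finset.one_lt_card.2 ⟨u, by simp, v, by simp [hr], huv⟩
  · rw [← hc u']
    refine Finset.card_lt_univ_of_notMem (x := v') (by simpa using hr')

end IsDivisible

end SimpleGraph

/-- An eigenvalue of a matrix annihilated by a split cubic is a root of the cubic. -/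
theorem Matrix.eigenvalue_of_cubic {V : Type*} [Fintype V] [DecidableEq V]
    {B N : Matrix V V ℝ} {t c₁ c₂ c₃ : ℝ}
    (hB : (B - c₁ • 1) * (B - c₂ • 1) * (B - c₃ • 1) = 0) (hN : B * N = t • N) (h0 : N ≠ 0) :
    t = c₁ ∨ t = c₂ ∨ t = c₃ := by
  have key (c : ℝ) : (B - c • 1) * N = (t - c) • N := by
    rw [sub_mul, hN, sub_smul, Matrix.smul_mul, one_mul]
  have h : ((t - c₃) * (t - c₂) * (t - c₁)) • N = 0 := by
    have h1 : (B - c₁ • 1) * (B - c₂ • 1) * (B - c₃ • 1) * N = 0 := by rw [hB, zero_mul]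
    rwa [mul_assoc, key, Matrix.mul_smul, mul_assoc, key, Matrix.mul_smul, key, smul_smul,
      smul_smul] at h1
  rcases smul_eq_zero.1 h with h | h
  · simp only [mul_eq_zero, sub_eq_zero] at h
    tauto
  · exact absurd h h0

/-! ### Consequences of the prescribed spectrum. -/

namespace SimpleGraph

variable {V : Type*} [Fintype V] [DecidableEq V] {G : SimpleGraph V} [DecidableRel G.Adj]

/-- The adjacency spectrum consisting of `k`, `√k` and `-√k` (`m` times each) and `-1`
(`k` times). -/
def HasCoverSpectrum (G : SimpleGraph V) [DecidableRel G.Adj] (k m : ℕ) : Prop :=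
  G.adjSpectrum =
      {(k : ℝ)} + Multiset.replicate m (Real.sqrt k) + Multiset.replicate k (-1 : ℝ) +
        Multiset.replicate m (-Real.sqrt k)

namespace HasCoverSpectrum

variable {k m : ℕ}

theorem card_eq (h : G.HasCoverSpectrum k m) : Fintype.card V = 2 * m + k + 1 := by
  rw [← G.card_adjSpectrum, h]
  simp only [Multiset.card_add, Multiset.card_singleton, Multiset.card_replicate]
  ring

theorem degree_eq (h : G.HasCoverSpectrum k m) {d : ℕ} (hd : G.IsRegularOfDegree d) : d = k := by
  have h1 := hd.sum_adjSpectrum_sq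
  have h2 := h.card_eq
  rw [h, h2] at h1
  simp only [Multiset.map_add, Multiset.map_singleton, Multiset.map_replicate, Multiset.sum_add,
    Multiset.sum_singleton, Multiset.sum_replicate, nsmul_eq_mul, neg_sq,
    Real.sq_sqrt (Nat.cast_nonneg' k)] at h1
  -- Both sides are the trace of `A²`: the spectrum gives `k² + 2mk + k = k n`.
  have h3 : (d : ℝ) * ((2 * m + k + 1 : ℕ) : ℝ) = k * ((2 * m + k + 1 : ℕ) : ℝ) := by
    rw [← h1]
    push_cast
    ring
  exact_mod_cast mul_right_cancel₀ (by positivity) h3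

theorem trace_pow_four (h : G.HasCoverSpectrum k m) :
    (G.adjMatrix ℝ ^ 4).trace = (k : ℝ) ^ 4 + 2 * m * k ^ 2 + k := by
  have h4 : √(k : ℝ) ^ 4 = k ^ 2 := by
    rw [show 4 = 2 * 2 from rfl, pow_mul, Real.sq_sqrt (Nat.cast_nonneg' k)]
  have h5 : (-√(k : ℝ)) ^ 4 = k ^ 2 := by rw [Even.neg_pow (by decide), h4]
  rw [G.isHermitian_adjMatrix_real.trace_pow, ← adjSpectrum, h]
  simp only [Multiset.map_add, Multiset.map_singleton, Multiset.map_replicate, Multiset.sum_add,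
    Multiset.sum_singleton, Multiset.sum_replicate, nsmul_eq_mul, h4, h5]
  ring

theorem aeval_adjMatrix (h : G.HasCoverSpectrum k m) :
    (G.adjMatrix ℝ + 1) * (G.adjMatrix ℝ - (k : ℝ) • 1) *
      (G.adjMatrix ℝ * G.adjMatrix ℝ - (k : ℝ) • 1) = 0 := by
  have h1 := G.isHermitian_adjMatrix_real.aeval_eq_zero
    ((X + 1) * (X - C (k : ℝ)) * (X * X - C (k : ℝ))) (fun t ht => by
      rw [← adjSpectrum, h] at ht
      have hs := Real.mul_self_sqrt (Nat.cast_nonneg' k (α := ℝ))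
      simp only [Multiset.mem_add, Multiset.mem_singleton, Multiset.mem_replicate] at ht
      rcases ht with ((rfl | ⟨-, rfl⟩) | ⟨-, rfl⟩) | ⟨-, rfl⟩ <;> simp [hs])
  simpa only [map_mul, map_sub, map_add, map_one, aeval_X, aeval_C,
    Algebra.algebraMap_eq_smul_one] using h1

/-- Passing to `A²` merges `±√k`; its eigenvalues are among `k²`, `1` and `k`. -/
theorem cubic_adjMatrix_sq (h : G.HasCoverSpectrum k m) :
    (G.adjMatrix ℝ * G.adjMatrix ℝ - ((k : ℝ) ^ 2) • 1) *
      (G.adjMatrix ℝ * G.adjMatrix ℝ - (1 : ℝ) • 1) *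
      (G.adjMatrix ℝ * G.adjMatrix ℝ - (k : ℝ) • 1) = 0 := by
  have h1 : (G.adjMatrix ℝ * G.adjMatrix ℝ - ((k : ℝ) ^ 2) • 1) *
      (G.adjMatrix ℝ * G.adjMatrix ℝ - (1 : ℝ) • 1) =
      ((G.adjMatrix ℝ + (k : ℝ) • 1) * (G.adjMatrix ℝ - 1)) *
        ((G.adjMatrix ℝ + 1) * (G.adjMatrix ℝ - (k : ℝ) • 1)) := by
    simp only [mul_add, add_mul, mul_sub, sub_mul, Matrix.mul_smul, Matrix.smul_mul, mul_one,
      one_mul, smul_smul, mul_assoc]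
    module
  rw [h1, mul_assoc, h.aeval_adjMatrix, mul_zero]

end HasCoverSpectrum

/-! ### Determination of the parameters. -/

namespace IsDivisible

variable {r : Setoid V} [DecidableRel r] {k m l₁ l₂ s : ℕ}

/-- The columns of `s I - R` have zero sum on every class, so `R` and `J` kill them. -/
theorem sq_mul_sub (h : G.IsDivisible r k l₁ l₂) (hs : ∀ x, r.classCard x = s) :
    (G.adjMatrix ℝ * G.adjMatrix ℝ) * ((s : ℝ) • 1 - r.relMatrix) =
      ((k : ℝ) - l₁) • ((s : ℝ) • (1 : Matrix V V ℝ) - r.relMatrix) := by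
  rw [h.adjMatrix_sq]
  simp only [add_mul, mul_sub, Matrix.smul_mul, Matrix.mul_smul, r.ones_mul_relMatrix hs,
    r.relMatrix_mul_self hs, one_mul, mul_one]
  module

/-- The columns of `n R - s J` are class-constant with total sum zero. -/
theorem sq_mul_centered (h : G.IsDivisible r k l₁ l₂) (hs : ∀ x, r.classCard x = s) :
    (G.adjMatrix ℝ * G.adjMatrix ℝ) * ((Fintype.card V : ℝ) • r.relMatrix -
        (s : ℝ) • (Matrix.of fun _ _ => 1)) =
      ((k : ℝ) ^ 2 - l₂ * Fintype.card V) • ((Fintype.card V : ℝ) • r.relMatrix -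
        (s : ℝ) • (Matrix.of fun _ _ => 1 : Matrix V V ℝ)) := by
  rcases isEmpty_or_nonempty V with _ | ⟨⟨x⟩⟩
  · exact Subsingleton.elim _ _
  have h0 := h.row_sum x
  rw [hs] at h0
  have h4 : (Matrix.of fun _ _ => 1 : Matrix V V ℝ) * (Matrix.of fun _ _ => 1) =
      (Fintype.card V : ℝ) • (Matrix.of fun _ _ => 1 : Matrix V V ℝ) := by
    ext x y
    simp [Matrix.mul_apply]
  rw [h.adjMatrix_sq, ← h0]
  simp only [add_mul, mul_sub, Matrix.smul_mul, Matrix.mul_smul, r.ones_mul_relMatrix hs,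
    r.relMatrix_mul_self hs, r.relMatrix_mul_ones hs, h4, one_mul]
  module

/-- Compared with the spectral value of the trace, this rules out `l₂ = 0` when `k - l₁ = 1`. -/
theorem trace_pow_four (h : G.IsDivisible r k l₁ 0) (hs : ∀ x, r.classCard x = s) :
    (G.adjMatrix ℝ ^ 4).trace = Fintype.card V *
      (((k : ℝ) - l₁) ^ 2 + 2 * (k - l₁) * l₁ + l₁ ^ 2 * s) := by
  have h3 : r.relMatrix.trace = Fintype.card V := by
    simp [Matrix.trace, Setoid.relMatrix]
  have h4 : G.adjMatrix ℝ ^ 4 = (((k : ℝ) - l₁) ^ 2) • (1 : Matrix V V ℝ) +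
      (2 * ((k : ℝ) - l₁) * l₁ + l₁ ^ 2 * s) • r.relMatrix := by
    rw [show 4 = 2 * 2 from rfl, pow_mul, pow_two (G.adjMatrix ℝ), pow_two, h.adjMatrix_sq]
    simp only [Nat.cast_zero, sub_zero, zero_smul, add_zero, add_mul, mul_add, Matrix.smul_mul,
      Matrix.mul_smul, r.relMatrix_mul_self hs, one_mul, mul_one]
    module
  rw [h4, Matrix.trace_add, Matrix.trace_smul, Matrix.trace_smul, h3, Matrix.trace_one]
  simp only [smul_eq_mul]
  ring

/-- The parameters forced by the spectrum and the divisibility condition. -/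
theorem parameters (h : G.IsDivisible r k l₁ l₂) (hsp : G.HasCoverSpectrum k m)
    (hdvd : (2 * m + k + 1 : ℤ) ∣ (k : ℤ) ^ 2 - 1) (hs : ∀ x, r.classCard x = s)
    (hs2 : 2 ≤ s) (hsn : s < Fintype.card V) :
    l₁ = 0 ∧ 2 ≤ k ∧ l₂ * Fintype.card V + 1 = k ^ 2 ∧ s * (k + 1) = Fintype.card V := by
  obtain ⟨x, y, hxy⟩ := h.exists_not_rel
  have hrow := h.row_sum x
  have hcard := hsp.card_eq
  rw [hs] at hrow
  set n := Fintype.card V with hn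
  have hs2' : (2 : ℝ) ≤ s := by exact_mod_cast hs2
  have hsn' : (s : ℝ) < n := by exact_mod_cast hsn
  have hne : (l₁ : ℝ) ≠ l₂ := by exact_mod_cast h.ne
  have hl₁ : (0 : ℝ) ≤ l₁ := Nat.cast_nonneg' _
  have hl₂ : (0 : ℝ) ≤ l₂ := Nat.cast_nonneg' _
  have hrow' : (k : ℝ) + l₁ * (s - 1) + l₂ * (n - s) = k ^ 2 := by rw [← hrow]; ring
  -- For `k ≤ 1` the row sum leaves no room for common neighbours, so `l₁ = l₂ = 0`.
  have hk : 2 ≤ k := by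
    by_contra hk
    have hk' : (k : ℝ) ^ 2 ≤ k := by
      have : k = 0 ∨ k = 1 := by omega
      rcases this with rfl | rfl <;> simp
    have h1 : 0 ≤ (l₁ : ℝ) * (s - 1) := mul_nonneg hl₁ (by linarith)
    have h2 : 0 ≤ (l₂ : ℝ) * (n - s) := mul_nonneg hl₂ (by linarith)
    have h3 : (l₁ : ℝ) * (s - 1) = 0 := by linarith
    have h4 : (l₂ : ℝ) * (n - s) = 0 := by linarith
    have h5 := (mul_eq_zero.1 h3).resolve_right (by linarith)
    have h6 := (mul_eq_zero.1 h4).resolve_right (by linarith)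
    exact hne (h5.trans h6.symm)
  have hk2 : (2 : ℝ) ≤ k := by exact_mod_cast hk
  have hkk : (k : ℝ) < k ^ 2 := by nlinarith
  -- The test matrices are nonzero because their diagonal entries are `s - 1` and `n - s`.
  have hN := Matrix.eigenvalue_of_cubic hsp.cubic_adjMatrix_sq (h.sq_mul_sub hs) (by
    intro h0
    have := congrFun₂ h0 x x
    simp [Setoid.relMatrix] at this
    linarith)
  have hM := Matrix.eigenvalue_of_cubic hsp.cubic_adjMatrix_sq (h.sq_mul_centered hs) (by
    intro h0
    have := congrFun₂ h0 x x
    simp [Setoid.relMatrix] at this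
    linarith)
  rw [← hn] at hM
  have hN : (k : ℝ) - l₁ = 1 ∨ (k : ℝ) - l₁ = k := hN.resolve_left (by linarith)
  have hdiff : (k : ℝ) ^ 2 - l₂ * n ≠ k - l₁ := by
    intro h0
    have : ((l₁ : ℝ) - l₂) * s = 0 := by linarith
    rcases mul_eq_zero.1 this with h1 | h1
    · exact hne (sub_eq_zero.1 h1)
    · linarith
  have hl₂_zero (h0 : (k : ℝ) ^ 2 - l₂ * n = k ^ 2) : l₂ = 0 := by
    have : (l₂ : ℝ) * n = 0 := by linarith
    exact_mod_cast (mul_eq_zero.1 this).resolve_right (by linarith)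
  rcases hN with hN | hN
  · exfalso
    rcases hM with hM | hM | hM
    · obtain rfl := hl₂_zero hM
      have h1 := h.trace_pow_four hs
      rw [hsp.trace_pow_four, ← hn] at h1
      have h2 : (l₁ : ℝ) = k - 1 := by linarith
      have h3 : (n : ℝ) = 2 * m + k + 1 := by exact_mod_cast hcard
      have h4 : (s : ℝ) = k + 1 := by
        rw [h2] at hrow'
        have : ((k : ℝ) - 1) * (s - (k + 1)) = 0 := by push_cast at hrow'; linarith
        have := (mul_eq_zero.1 this).resolve_left (by linarith)
        linarith
      -- The two values of the trace of `A⁴` force `n = k + 1 = s`, against `s < n`.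
      have h5 : (k : ℝ) * (k - 1) ^ 2 * (n - (k + 1)) = 0 := by
        rw [h2, h4] at h1
        have : (2 * m : ℝ) = n - k - 1 := by linarith
        rw [this] at h1
        linear_combination -h1
      have h6 : (k : ℝ) * (k - 1) ^ 2 ≠ 0 :=
        mul_ne_zero (by linarith) (pow_ne_zero _ (by linarith))
      have := (mul_eq_zero.1 h5).resolve_left h6
      linarith
    · exact hdiff (hM.trans hN.symm)
    -- Here `n` divides `k² - k`, hence also `k - 1`, which is positive and smaller than `n`.
    · have h1 : (k : ℤ) ^ 2 - k = l₂ * (2 * m + k + 1) := by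
        have : (k : ℝ) ^ 2 - k = l₂ * n := by linarith
        rw [hcard] at this
        exact_mod_cast this
      have h2 : (2 * m + k + 1 : ℤ) ∣ (k : ℤ) - 1 := by
        have h3 : (2 * m + k + 1 : ℤ) ∣ (k : ℤ) ^ 2 - k := ⟨l₂, by rw [h1, mul_comm]⟩
        have := dvd_sub hdvd h3
        rwa [show (k : ℤ) ^ 2 - 1 - (k ^ 2 - k) = k - 1 by ring] at this
      have := Int.le_of_dvd (by omega) h2
      omega
  · have hl0 : l₁ = 0 := by
      have : (l₁ : ℝ) = 0 := by linarith
      exact_mod_cast this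
    subst hl0
    rcases hM with hM | hM | hM
    · exact absurd (hl₂_zero hM).symm h.ne
    · have h1 : (l₂ : ℝ) * n + 1 = k ^ 2 := by linarith
      have h2 : (l₂ : ℝ) * s + 1 = k := by push_cast at hrow'; linarith
      have h3 : (l₂ : ℝ) * (s * (k + 1)) = l₂ * n := by linear_combination (k + 1) * h2 - h1
      refine ⟨rfl, hk, by exact_mod_cast h1, ?_⟩
      have h4 : (l₂ : ℝ) ≠ 0 := by simpa using hne.symm
      exact_mod_cast mul_left_cancel₀ h4 h3
    · exact absurd (hM.trans hN.symm) hdiff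

/-- Every vertex has exactly one neighbour in each class other than its own, and none in its
own. -/
theorem card_neighbors_in_class (h : G.IsDivisible r k l₁ l₂) (hsp : G.HasCoverSpectrum k m)
    (hs : ∀ x, r.classCard x = s) (hs2 : 2 ≤ s) (hk : 2 ≤ k)
    (hl : l₂ * Fintype.card V + 1 = k ^ 2) (hsk : s * (k + 1) = Fintype.card V) (x c : V) :
    ((G.neighborFinset x).filter fun z => r z c).card = if r x c then 0 else 1 := by
  have hM := h.sq_mul_centered hs
  set M := (Fintype.card V : ℝ) • r.relMatrix - (s : ℝ) • (Matrix.of fun _ _ => 1 : Matrix V V ℝ)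
    with hMdef
  set A := G.adjMatrix ℝ with hA
  have h1 : (k : ℝ) ^ 2 - l₂ * Fintype.card V = 1 := by
    have : (l₂ : ℝ) * Fintype.card V + 1 = k ^ 2 := by exact_mod_cast hl
    linarith
  rw [h1, one_smul] at hM
  have h2 := congrArg (· * M) hsp.aeval_adjMatrix
  simp only [← hA, zero_mul] at h2
  have h3 : (A * A - (k : ℝ) • 1) * M = (1 - (k : ℝ)) • M := by
    rw [sub_mul, hM, Matrix.smul_mul, one_mul, sub_smul, one_smul]
  -- Since `A² M = M`, the factor `A - k` contributes a scalar as well, and the annihilating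
  -- polynomial reduces to `(1 - k)² (A + 1) M = 0`.
  have h4 : (A + 1) * (A - (k : ℝ) • 1) * M = (1 - (k : ℝ)) • (A * M + M) := by
    have : (A + 1) * (A - (k : ℝ) • 1) * M = A * A * M - (k : ℝ) • (A * M) + A * M
        - (k : ℝ) • M := by
      simp only [add_mul, mul_sub, sub_mul, Matrix.mul_smul, Matrix.smul_mul, mul_one, one_mul]
      module
    rw [this, hM]
    module
  have hk' : (1 - (k : ℝ)) ≠ 0 := by
    have : (2 : ℝ) ≤ k := by exact_mod_cast hk
    linarith
  rw [mul_assoc, h3, Matrix.mul_smul, h4, smul_smul] at h2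
  have h5 := (smul_eq_zero.1 h2).resolve_left (mul_ne_zero hk' hk')
  have h6 := congrFun₂ h5 x c
  have h7 : (A * r.relMatrix) x c = ((G.neighborFinset x).filter fun z => r z c).card := by
    rw [hA, adjMatrix_mul_apply]
    simp [Setoid.relMatrix]
  have h8 : (A * (Matrix.of fun _ _ => 1 : Matrix V V ℝ)) x c = (k : ℝ) := by
    rw [hA, adjMatrix_mul_apply]
    simp [h.regular.degree_eq]
  rw [hMdef, mul_sub, Matrix.mul_smul, Matrix.mul_smul] at h6
  simp only [Matrix.add_apply, Matrix.sub_apply, Matrix.smul_apply, h7, h8, smul_eq_mul,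
    Matrix.zero_apply, Matrix.of_apply] at h6
  have h9 : (s : ℝ) * (k + 1) = Fintype.card V := by exact_mod_cast hsk
  have h10 : (0 : ℝ) < Fintype.card V := by
    rw [← h9]
    have : (2 : ℝ) ≤ s := by exact_mod_cast hs2
    positivity
  have h11 : (Fintype.card V : ℝ) * ((((G.neighborFinset x).filter fun z => r z c).card : ℝ) -
      (1 - r.relMatrix x c)) = 0 := by linear_combination h6 + h9
  have h12 := (mul_eq_zero.1 h11).resolve_left h10.ne'
  have h13 : (((G.neighborFinset x).filter fun z => r z c).card : ℝ) =
      ((if r x c then 0 else 1 : ℕ) : ℝ) := by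
    rw [sub_eq_zero.1 h12, Setoid.relMatrix, Matrix.of_apply]
    split_ifs <;> simp
  exact_mod_cast h13

end IsDivisible

end SimpleGraph

/-! ### Antipodal covers of complete graphs are distance-regular. -/

namespace SimpleGraph

/-- An antipodal cover of a complete graph: the classes of `r` are cocliques, each vertex has
exactly one neighbour in every class other than its own, and two vertices have `μ` common
neighbours if they lie in different classes and none if they are distinct in the same class. -/
structure IsAntipodalCover {V : Type*} (G : SimpleGraph V) (r : Setoid V) (k μ : ℕ) : Prop where
  finite : Finite V
  degree : ∀ x, {z | G.Adj x z}.ncard = k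
  degree_pos : 0 < k
  mu_pos : 0 < μ
  not_rel : ∀ x y, G.Adj x y → ¬ r x y
  matching : ∀ x y, ¬ r x y → {z | G.Adj y z ∧ r x z}.ncard = 1
  common_of_rel : ∀ x y, x ≠ y → r x y → ∀ z, G.Adj x z → ¬ G.Adj y z
  common_of_not_rel : ∀ x y, ¬ r x y → {z | G.Adj y z ∧ G.Adj x z}.ncard = μ
  exists_rel : ∃ x y, x ≠ y ∧ r x y

namespace IsAntipodalCover

variable {V : Type*} {G : SimpleGraph V} {r : Setoid V} {k μ : ℕ}

theorem exists_common (h : G.IsAntipodalCover r k μ) {x y : V} (hxy : ¬ r x y) :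
    ∃ z, G.Adj x z ∧ G.Adj z y := by
  obtain ⟨z, hz⟩ := Set.nonempty_of_ncard_ne_zero
    (by rw [h.common_of_not_rel x y hxy]; exact h.mu_pos.ne')
  exact ⟨z, hz.2, hz.1.symm⟩

/-- A neighbour of `x` lies outside the common class of `x` and `y`, so it shares a neighbour with
`y`. -/
theorem exists_walk_three (h : G.IsAntipodalCover r k μ) {x y : V} (hxy : r x y) :
    ∃ p : G.Walk x y, p.length = 3 := by
  obtain ⟨z, hz⟩ := Set.nonempty_of_ncard_ne_zero (by rw [h.degree x]; exact h.degree_pos.ne')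
  have hxz := h.not_rel x z hz
  obtain ⟨w, hzw, hwy⟩ := h.exists_common (x := z) (y := y)
    fun hzy => hxz (r.trans hxy (r.symm hzy))
  exact ⟨.cons hz (.cons hzw (.cons hwy .nil)), rfl⟩

theorem connected (h : G.IsAntipodalCover r k μ) : G.Connected := by
  obtain ⟨u, -⟩ := h.exists_rel
  refine @Connected.mk _ _ (fun x y => ?_) ⟨u⟩
  by_cases hxy : r x y
  · obtain ⟨p, -⟩ := h.exists_walk_three hxy
    exact p.reachable
  · obtain ⟨z, hxz, hzy⟩ := h.exists_common hxy
    exact hxz.reachable.trans hzy.reachable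

theorem dist_of_rel (h : G.IsAntipodalCover r k μ) {x y : V} (hne : x ≠ y) (hxy : r x y) :
    G.dist x y = 3 := by
  obtain ⟨p, hp⟩ := h.exists_walk_three hxy
  have hle : G.dist x y ≤ 3 := hp ▸ dist_le p
  have h2 : 2 < G.edist x y := by
    refine two_lt_edist_iff.2 ⟨hne, fun hadj => h.not_rel x y hadj hxy, ?_⟩
    refine Set.eq_empty_of_forall_notMem fun z hz => ?_
    exact h.common_of_rel x y hne hxy z hz.1 hz.2
  rw [← (h.connected.preconnected x y).coe_dist_eq_edist] at h2
  have h3 : 2 < G.dist x y := by exact_mod_cast h2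
  omega

theorem dist_of_not_rel (h : G.IsAntipodalCover r k μ) {x y : V} (hxy : ¬ r x y)
    (hadj : ¬ G.Adj x y) : G.dist x y = 2 := by
  obtain ⟨z, hxz, hzy⟩ := h.exists_common hxy
  have : G.edist x y = 2 :=
    edist_eq_two_iff.2 ⟨fun he => hxy (he ▸ r.refl x), hadj, ⟨z, hxz, hzy.symm⟩⟩
  rw [dist, this]
  rfl

theorem dist_cases (h : G.IsAntipodalCover r k μ) (x y : V) :
    (x = y ∧ G.dist x y = 0) ∨ (¬ r x y ∧ G.Adj x y ∧ G.dist x y = 1) ∨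
      (¬ r x y ∧ ¬ G.Adj x y ∧ G.dist x y = 2) ∨
      (x ≠ y ∧ r x y ∧ ¬ G.Adj x y ∧ G.dist x y = 3) := by
  by_cases hxy : x = y
  · exact .inl ⟨hxy, by simp [hxy]⟩
  · by_cases hr : r x y
    · exact .inr (.inr (.inr ⟨hxy, hr, fun hadj => h.not_rel x y hadj hr, h.dist_of_rel hxy hr⟩))
    · by_cases hadj : G.Adj x y
      · exact .inr (.inl ⟨hr, hadj, dist_eq_one_iff_adj.2 hadj⟩)
      · exact .inr (.inr (.inl ⟨hr, hadj, h.dist_of_not_rel hr hadj⟩))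

theorem dist_eq_one_iff (_ : G.IsAntipodalCover r k μ) {x y : V} :
    G.dist x y = 1 ↔ G.Adj x y := dist_eq_one_iff_adj

theorem dist_eq_two_iff (h : G.IsAntipodalCover r k μ) {x y : V} :
    G.dist x y = 2 ↔ ¬ r x y ∧ ¬ G.Adj x y := by
  have := h.dist_cases x y
  have hr := r.refl x
  constructor
  · grind
  · exact fun hh => h.dist_of_not_rel hh.1 hh.2

theorem dist_eq_three_iff (h : G.IsAntipodalCover r k μ) {x y : V} :
    G.dist x y = 3 ↔ x ≠ y ∧ r x y := by
  have := h.dist_cases x y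
  constructor
  · grind
  · exact fun hh => h.dist_of_rel hh.1 hh.2

theorem dist_le_three (h : G.IsAntipodalCover r k μ) (x y : V) : G.dist x y ≤ 3 := by
  have := h.dist_cases x y
  omega

theorem diam_eq (h : G.IsAntipodalCover r k μ) : G.diam = 3 := by
  obtain ⟨u, v, huv, hr⟩ := h.exists_rel
  have := h.finite
  have : Nonempty V := ⟨u⟩
  obtain ⟨x, y, hxy⟩ := G.exists_dist_eq_diam
  refine le_antisymm (hxy ▸ h.dist_le_three x y) ?_
  rw [← h.dist_of_rel huv hr]
  exact dist_le_diam (connected_iff_ediam_ne_top.1 h.connected)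

theorem isAntipodal (h : G.IsAntipodalCover r k μ) : G.IsAntipodal := by
  intro x y z hxy hyz hxz
  refine ⟨hxz, ?_⟩
  have h1 := hxy.2
  have h2 := hyz.2
  rw [h.diam_eq] at h1 h2 ⊢
  exact h.dist_of_rel hxz (r.trans (h.dist_eq_three_iff.1 h1).2 (h.dist_eq_three_iff.1 h2).2)

/-- Among the neighbours of a vertex `y` in a different class than `x`, all but the `μ` common
neighbours with `x` and the one vertex in the class of `x` are at distance two from `x`. -/
theorem ncard_dist_two (h : G.IsAntipodalCover r k μ) {x y : V} (hxy : ¬ r x y) :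
    {z | G.Adj y z ∧ G.dist x z = 2}.ncard = k - μ - 1 := by
  have := h.finite
  have h1 : {z | G.Adj y z ∧ G.dist x z = 2} =
      ({z | G.Adj y z} \ {z | G.Adj y z ∧ G.Adj x z}) \ {z | G.Adj y z ∧ r x z} := by
    ext z
    simp only [h.dist_eq_two_iff, Set.mem_ofPred_eq, Set.mem_sdiff]
    tauto
  rw [h1, Set.ncard_sdiff, Set.ncard_sdiff, h.degree, h.common_of_not_rel x y hxy,
    h.matching x y hxy]
  · exact fun z hz => hz.1
  · exact fun z hz => ⟨hz.1, fun hz' => h.not_rel x z hz'.2 hz.2⟩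

theorem isDistanceRegularWith (h : G.IsAntipodalCover r k μ) :
    G.IsDistanceRegularWith
      (fun i => if i = 1 then μ else if i = 2 then k - μ - 1 else 0)
      (fun i => if i = 0 then k else if i = 1 then k - μ - 1 else if i = 2 then 1 else 0)
      (fun i => if i = 1 then 1 else if i = 2 then μ else if i = 3 then k else 0) := by
  have h0 (x z : V) : G.dist x z = 0 ↔ x = z := h.connected.dist_eq_zero_iff
  have hempty {p : V → Prop} (hp : ∀ z, ¬ p z) : {z | p z}.ncard = 0 := by
    simp [Set.eq_empty_of_forall_notMem (s := {z | p z}) hp]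
  have hcongr {p q : V → Prop} {n : ℕ} (hq : {z | q z}.ncard = n) (hpq : ∀ z, p z ↔ q z) :
      {z | p z}.ncard = n := by
    rw [← hq]
    congr 1
    exact Set.ext hpq
  refine ⟨h.finite, h.connected, fun i hi x y hd => ?_, fun i hi x y hd => ?_,
    fun i hi x y hd => ?_⟩ <;> rw [h.diam_eq] at hi <;> obtain rfl | rfl | rfl | rfl :
      i = 0 ∨ i = 1 ∨ i = 2 ∨ i = 3 := by omega
  · obtain rfl := (h0 x y).1 hd
    exact hcongr (h.degree x) fun z => by simp [h.dist_eq_one_iff]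
  · exact h.ncard_dist_two (h.not_rel x y (h.dist_eq_one_iff.1 hd))
  · refine hcongr (h.matching x y (h.dist_eq_two_iff.1 hd).1) fun z => ?_
    have hadj := (h.dist_eq_two_iff.1 hd).2
    -- The unique neighbour of `y` in the class of `x` is not `x` itself, hence is at distance
    -- three.
    have hzx : G.Adj y z → x ≠ z := fun hz he => hadj (he ▸ hz.symm)
    simp only [Nat.reduceAdd, h.dist_eq_three_iff]
    tauto
  · exact hempty fun z hz => by have := h.dist_le_three x z; omega
  · obtain rfl := (h0 x y).1 hd
    exact hempty fun z hz => hz.1.ne ((h0 _ _).1 hz.2)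
  · exact hcongr (h.common_of_not_rel x y (h.not_rel x y (h.dist_eq_one_iff.1 hd)))
      fun z => by rw [h.dist_eq_one_iff]
  · exact h.ncard_dist_two (h.dist_eq_two_iff.1 hd).1
  -- A neighbour of `y` at distance three from `x` would lie in the class of `y`, which is a
  -- coclique.
  · refine hempty fun z hz => h.not_rel y z hz.1 ?_
    exact r.trans (r.symm (h.dist_eq_three_iff.1 hd).2) (h.dist_eq_three_iff.1 hz.2).2
  · exact hempty fun z hz => by omega
  · have hadj := h.dist_eq_one_iff.1 hd
    refine hcongr (Set.ncard_singleton x) fun z => ?_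
    simp only [Nat.add_eq_right, h0]
    exact ⟨fun hz => hz.2.symm, fun hz => ⟨hz ▸ hadj.symm, hz.symm⟩⟩
  · exact hcongr (h.common_of_not_rel x y (h.dist_eq_two_iff.1 hd).1)
      fun z => by simp [h.dist_eq_one_iff]
  · obtain ⟨hne, hr⟩ := h.dist_eq_three_iff.1 hd
    refine hcongr (h.degree y) fun z => ?_
    simp only [Nat.reduceEqDiff, h.dist_eq_two_iff]
    refine ⟨fun hz => hz.1, fun hz => ⟨hz, fun hxz => ?_, fun hxz => ?_⟩⟩
    · exact h.not_rel y z hz (r.trans (r.symm hr) hxz)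
    · exact h.common_of_rel x y hne hr z hxz hz

end IsAntipodalCover

theorem IsDivisible.isAntipodalCover {V : Type*} [Fintype V] [DecidableEq V] {G : SimpleGraph V}
    [DecidableRel G.Adj] {r : Setoid V} {k m l₁ l₂ : ℕ} (h : G.IsDivisible r k l₁ l₂)
    (hsp : G.HasCoverSpectrum k m) (hdvd : (2 * m + k + 1 : ℤ) ∣ (k : ℤ) ^ 2 - 1) :
    G.IsAntipodalCover r k l₂ ∧ l₂ * Fintype.card V + 1 = k ^ 2 := by
  classical
  obtain ⟨s, hs, hs2, hsn⟩ := h.exists_classCard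
  obtain ⟨rfl, hk, hl, hsk⟩ := h.parameters hsp hdvd hs hs2 hsn
  have hmatch := h.card_neighbors_in_class hsp hs hs2 hk hl hsk
  refine ⟨⟨inferInstance, fun x => ?_, by omega, Nat.pos_of_ne_zero h.ne.symm,
    fun x y hxy hr => ?_, fun x y hxy => ?_, fun x y hne hr z hxz hyz => ?_, fun x y hxy => ?_,
    h.exists_rel⟩, hl⟩
  · rw [← h.regular.degree_eq x, ← card_neighborSet_eq_degree, ← Nat.card_eq_fintype_card]
    rfl
  · have h1 := hmatch x x
    rw [if_pos (r.refl x), Finset.card_eq_zero] at h1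
    have : y ∈ (G.neighborFinset x).filter fun z => r z x := by simp [hxy, r.symm hr]
    simp [h1] at this
  · have h1 := hmatch y x
    rw [if_neg fun hyx => hxy (r.symm hyx)] at h1
    rw [← h1, ← Set.ncard_coe_finset]
    congr 1
    ext z
    simp [r.comm']
  · have h1 := h.common_of_rel x y hne hr
    rw [Fintype.card_eq_zero_iff] at h1
    exact h1.elim ⟨z, hxz, hyz⟩
  · rw [← h.common_of_not_rel x y hxy, ← Nat.card_eq_fintype_card, Nat.card_coe_set_eq]
    congr 1
    ext z
    exact and_comm

end SimpleGraph

/-! ### The corollary. -/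

theorem mainTheorem10 {V : Type*} [Fintype V] [DecidableEq V] (G : SimpleGraph V)
    [DecidableRel G.Adj] (k m : ℕ)
    (hG : G.IsDivisibleDesignGraph)
    (hspec : G.adjSpectrum =
      {(k : ℝ)} + Multiset.replicate m (Real.sqrt k) + Multiset.replicate k (-1 : ℝ) +
        Multiset.replicate m (-Real.sqrt k))
    (hdvd : (2 * m + k + 1 : ℤ) ∣ (k : ℤ) ^ 2 - 1) :
    ∃ a b c : ℕ → ℕ, G.IsDistanceRegularWith a b c ∧ G.diam = 3 ∧ G.IsAntipodal ∧
      a 1 = c 2 ∧ (a 1 : ℚ) = ((k : ℚ) ^ 2 - 1) / (2 * m + k + 1) := by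
  have hsp : G.HasCoverSpectrum k m := hspec
  obtain ⟨r, d, l₁, l₂, h⟩ := hG.exists_isDivisible
  obtain rfl := hsp.degree_eq h.regular
  obtain ⟨hc, hl⟩ := h.isAntipodalCover hsp hdvd
  refine ⟨_, _, _, hc.isDistanceRegularWith, hc.diam_eq, hc.isAntipodal, rfl, ?_⟩
  rw [hsp.card_eq] at hl
  rw [eq_div_iff (by positivity), if_pos rfl]
  have : (l₂ : ℚ) * (2 * m + d + 1) + 1 = d ^ 2 := by exact_mod_cast hl
  linarith
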